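/- All graphs are finite and simple, and may have no vertices. A graph polynomial is a map $f$ assigning to every graph $G$ a polynomial $f(G,x)\in\mathbb C[x]$; write $a_1(G)$ for the coefficient of $x$ in $f(G,x)$. It is \emph{multiplicative} if $f(G_1\uplus G_2,x)=f(G_1,x)f(G_2,x)$ for all graphs $G_1,G_2$, where $\uplus$ denotes the disjoint union. Given $R:\mathbb N\to[0,\infty)$ (where $0\in\mathbb N$), $f$ is \emph{of bounded exponential type with bounding function $R$} if (i) $f(G,x)$ is monic of degree $|V(G)|$ for every graph $G$; (ii) $f(\emptyset,x)=1$, and $\sum_{S\subseteq V(G)}f(G[S],x)\,f(G[V(G)\setminus S],y)=f(G,x+y)$ for every graph $G$; (iii) for every $\Delta\in\mathbb N$, every graph $G$ with all degrees at most $\Delta$, every vertex $v\in V(G)$ and every integer $t\ge 1$, $$\sum_{v\in S\subseteq V(G),\ |S|=t}|a_1(G[S])|\le R(\Delta)^{t-1}\qquad(\text{with }0^0=1).$$ Let $ch(G,x)$ be the chromatic polynomial of $G$, i.e. the unique polynomial whose value at each positive integer $q$ is the number of proper colorings of $G$ with $q$ colors. For $v_0\in\mathbb C$ let $Z_G(q,v_0)=\sum_{A\subseteq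 E(G)}q^{k(A)}v_0^{|A|}$, regarded as a polynomial in $q$, where $k(A)$ is the number of connected components of the graph $(V(G),A)$ and $v_0^0=1$. \textbf{Proposition.} (a) The chromatic polynomial $ch$ is multiplicative and of bounded exponential type with bounding function $R(\Delta)=e\Delta$. (b) For every $v_0\in\mathbb C$, the Tutte polynomial $G\mapsto Z_G(q,v_0)$ is multiplicative and of bounded exponential type with bounding function $R(\Delta)=e\Delta(1+|v_0|)^{\Delta}$. -/

import Mathlib

open Polynomial Finset

universe u

/-- A graph polynomial assigns a complex polynomial to every finite simple graph. -/
def GraphPolynomial : Type (u + 1) :=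
  ∀ (V : Type u) [Finite V], SimpleGraph V → ℂ[X]

namespace GraphPolynomial

/-- `f(G, x)` is monic of degree `|V(G)|` for all graphs `G`. -/
def IsMonic (f : GraphPolynomial.{u}) : Prop :=
  ∀ (V : Type u) [Finite V] (G : SimpleGraph V),
    (f V G).Monic ∧ (f V G).natDegree = Nat.card V

/-- `f(∅, x) = 1` and `∑_{S ⊆ V(G)} f(G[S], x) f(G - S, y) = f(G, x + y)`. -/
structure IsExponentialType (f : GraphPolynomial.{u}) : Prop where
  map_empty : ∀ (V : Type u) [Finite V] [IsEmpty V] (G : SimpleGraph V), f V G = 1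
  sum_eq : ∀ (V : Type u) [Fintype V] (G : SimpleGraph V) (x y : ℂ),
    ∑ S : Finset V,
        (f (S : Set V) (G.induce (S : Set V))).eval x *
          (f ((S : Set V)ᶜ : Set V) (G.induce (S : Set V)ᶜ)).eval y
      = (f V G).eval (x + y)

/-- `f` is of bounded exponential type with bounding function `R`. -/
structure IsBoundedExponentialType (f : GraphPolynomial.{u}) (R : ℕ → ℝ) : Prop where
  isMonic : f.IsMonic
  isExponentialType : f.IsExponentialType
  bound_nonneg : ∀ Δ, 0 ≤ R Δ
  sum_le : ∀ (Δ : ℕ) (V : Type u) [Fintype V] [DecidableEq V] (G : SimpleGraph V)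
    [DecidableRel G.Adj], (∀ w, G.degree w ≤ Δ) → ∀ (v : V) (t : ℕ), 1 ≤ t →
      ∑ S : Finset V with v ∈ S ∧ #S = t, ‖(f (S : Set V) (G.induce (S : Set V))).coeff 1‖
        ≤ R Δ ^ (t - 1)

/-- `f(G₁ ⊎ G₂, x) = f(G₁, x) f(G₂, x)`. -/
def IsMultiplicative (f : GraphPolynomial.{u}) : Prop :=
  ∀ (V₁ V₂ : Type u) [Finite V₁] [Finite V₂] (G₁ : SimpleGraph V₁) (G₂ : SimpleGraph V₂),
    f (V₁ ⊕ V₂) (G₁ ⊕g G₂) = f V₁ G₁ * f V₂ G₂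

end GraphPolynomial

/-- The value of `p` at each positive integer `q` is the number of proper `q`-colorings of `G`. -/
def CountsColorings {V : Type u} (G : SimpleGraph V) (p : ℂ[X]) : Prop :=
  ∀ q : ℕ, 0 < q → p.eval (q : ℂ) = Nat.card (G.Coloring (Fin q))

/-- The proper colorings of `G`, sorted by their partition into color classes. -/
theorem card_coloring_eq {V : Type u} [Finite V] (G : SimpleGraph V)
    [Fintype {s : Setoid V // ∀ v w, G.Adj v w → ¬ s v w}] (q : ℕ) :
    Nat.card (G.Coloring (Fin q)) =
      ∑ s : {s : Setoid V // ∀ v w, G.Adj v w → ¬ s v w},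
        q.descFactorial (Nat.card (Quotient s.1)) := by
  classical
  let F : (Σ s : {s : Setoid V // ∀ v w, G.Adj v w → ¬ s v w}, (Quotient s.1 ↪ Fin q)) →
      G.Coloring (Fin q) := fun p =>
    SimpleGraph.Coloring.mk (fun v => p.2 (Quotient.mk _ v))
      fun {v w} h h' => p.1.2 v w h (Quotient.exact (p.2.injective h'))
  have hF : F.Bijective := by
    constructor
    · rintro ⟨⟨s, hs⟩, g⟩ ⟨⟨s', hs'⟩, g'⟩ h
      have hv : ∀ v, g (Quotient.mk s v) = g' (Quotient.mk s' v) := fun v => DFunLike.congr_fun h v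
      have hss : s = s' := by
        ext a b
        constructor
        · intro hab
          refine Quotient.exact (g'.injective ?_)
          rw [← hv, ← hv, Quotient.sound hab]
        · intro hab
          refine Quotient.exact (g.injective ?_)
          rw [hv, hv, Quotient.sound hab]
      subst hss
      have hg : g = g' := by
        ext ⟨a⟩
        exact congrArg Fin.val (hv a)
      rw [hg]
    · intro c
      refine ⟨⟨⟨Setoid.ker c, fun v w h => c.valid h⟩, ⟨Quotient.lift c fun _ _ h => h, ?_⟩⟩, ?_⟩
      · rintro ⟨a⟩ ⟨b⟩ h
        exact Quotient.sound h
      · ext v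
        rfl
  have (s : Setoid V) : Fintype (Quotient s) := Fintype.ofFinite _
  rw [← Nat.card_eq_of_bijective F hF, Nat.card_eq_fintype_card, Fintype.card_sigma]
  exact Finset.sum_congr rfl fun s _ => by
    rw [Fintype.card_embedding_eq, Fintype.card_fin, Nat.card_eq_fintype_card]

/-- The chromatic polynomial exists and is unique. -/
theorem existsUnique_countsColorings {V : Type u} [Finite V] (G : SimpleGraph V) :
    ∃! p : ℂ[X], CountsColorings G p := by
  classical
  have : Finite (Setoid V) := Finite.of_injective (fun s : Setoid V => s.r) fun s t h =>
    Setoid.ext fun a b => by simpa using congrFun (congrFun h a) b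
  have := Fintype.ofFinite {s : Setoid V // ∀ v w, G.Adj v w → ¬ s v w}
  refine existsUnique_of_exists_of_unique
    ⟨∑ s : {s : Setoid V // ∀ v w, G.Adj v w → ¬ s v w},
      descPochhammer ℂ (Nat.card (Quotient s.1)), fun q _ => ?_⟩ fun p p' hp hp' => ?_
  · rw [card_coloring_eq, eval_finsetSum]
    push_cast
    exact Finset.sum_congr rfl fun s _ => descPochhammer_eval_eq_descFactorial ℂ q _
  · refine eq_of_infinite_eval_eq p p' (Set.Infinite.mono (s := Set.range fun n : ℕ =>
      ((n + 1 : ℕ) : ℂ)) ?_ (Set.infinite_range_of_injective fun m n h => ?_))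
    · rintro _ ⟨n, rfl⟩
      exact (hp _ n.succ_pos).trans (hp' _ n.succ_pos).symm
    · simpa using h

/-- The chromatic polynomial `ch(G, x)`. -/
noncomputable def chromaticPolynomial : GraphPolynomial.{u} :=
  fun _ _ G => (existsUnique_countsColorings G).choose

/-- The Tutte polynomial `Z_G(q, v₀) = ∑_{A ⊆ E(G)} q^{k(A)} v₀^{|A|}` as a polynomial in `q`, where
`k(A)` is the number of connected components of the spanning subgraph `(V, A)`. -/
noncomputable def tuttePolynomial (v₀ : ℂ) : GraphPolynomial.{u} :=
  fun V _ G => ∑ A ∈ (Set.toFinite G.edgeSet).toFinset.powerset,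
    X ^ Nat.card (SimpleGraph.fromEdgeSet (A : Set (Sym2 V))).ConnectedComponent * C (v₀ ^ #A)

/-! At a natural number q, Z_G(q, v₀) is the Potts partition function: a sum over all maps V → [q],
with a factor 1 + v₀ per monochromatic edge. Multiplicativity and the binomial identity thus become
statements about colorings: with a + b colors, choose the set S colored by the first a; edges
leaving S contribute 1. Both extend to polynomials because they hold at infinitely many points. For
v₀ = -1 the weight is the indicator of proper colorings, so ch = Z(·, -1) and only Z needs
treatment.

For the bound, a₁(G[S]) is the sum of v₀^|A| over the connected spanning edge sets A of G[S]. It is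
generalised to `rootedSum`, where every component of A must meet a root set U. Deleting a root u
promotes the neighbors joined to it by A to roots, while edges from u to other roots are
unconstrained and give 1 + v₀ each (`rootedSum_eq_mul_sum`). Let M ≥ |1 + v₀|^a |v₀|^b whenever a +
b ≤ Δ. Division by M^(|S|-1) leaves a recursive inequality without weights, which
`sum_rooted_le_treeBound` compares with the coefficients of exp(dT), T = z exp(ΔT); these are at
most (eΔ)^n for d = Δ (`treeBound_self_le`). M = 1 works for v₀ = -1, and M = (1 + |v₀|)^Δ always.
-/

/-! ### The Potts model. -/

section Potts

/-- The weight of the coloring `σ` in the Potts model on `G`: every monochromatic edge contributes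
a factor `1 + v₀`. -/
noncomputable def pottsWeight {V C : Type*} [Finite V] [DecidableEq C] (v₀ : ℂ) (G : SimpleGraph V)
    (σ : V → C) : ℂ :=
  ∏ e ∈ (Set.toFinite G.edgeSet).toFinset, (1 + if (Sym2.map σ e).IsDiag then v₀ else 0)

theorem card_fun_constant_on_edges {V C : Type*} [Finite V] [Finite C]
    (A : Set (Sym2 V)) :
    Nat.card {σ : V → C // ∀ e ∈ A, (Sym2.map σ e).IsDiag} =
      Nat.card C ^ Nat.card (SimpleGraph.fromEdgeSet A).ConnectedComponent := by
  rw [← Nat.card_fun]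
  refine Nat.card_congr
    { toFun := fun σ => SimpleGraph.ConnectedComponent.lift σ.1 ?_
      invFun := fun τ => ⟨fun v => τ (SimpleGraph.connectedComponentMk _ v), ?_⟩
      left_inv := fun σ => rfl
      right_inv := fun τ => ?_ }
  · intro v w p _
    induction p with
    | nil => rfl
    | cons h _ ih =>
      rw [← ih (SimpleGraph.Walk.IsPath.of_cons ‹_›)]
      exact σ.2 _ (SimpleGraph.fromEdgeSet_adj _ |>.1 h).1
  · intro e
    induction e with
    | _ a b =>
      intro h
      rw [Sym2.map_mk, Sym2.mk_isDiag_iff]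
      by_cases hab : a = b
      · rw [hab]
      · exact congrArg τ (SimpleGraph.ConnectedComponent.sound
          (SimpleGraph.Adj.reachable ((SimpleGraph.fromEdgeSet_adj _).2 ⟨h, hab⟩)))
  · ext c
    induction c using SimpleGraph.ConnectedComponent.ind
    rfl

/-- The Fortuin–Kasteleyn representation. -/
theorem eval_tuttePolynomial_card {V : Type u} {C : Type*} [Fintype V] [DecidableEq V] [Fintype C]
    [DecidableEq C] (v₀ : ℂ) (G : SimpleGraph V) :
    (tuttePolynomial v₀ V G).eval (Fintype.card C : ℂ) = ∑ σ : V → C, pottsWeight v₀ G σ := by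
  -- Expanding the product over edges gives a sum over edge sets A; for fixed A, exactly the q^k(A)
  -- maps constant on the components of A survive.
  simp only [pottsWeight, Finset.prod_one_add]
  rw [Finset.sum_comm, tuttePolynomial, eval_finsetSum]
  refine Finset.sum_congr rfl fun A _ => ?_
  have h : ∀ σ : V → C, (∏ e ∈ A, if (Sym2.map σ e).IsDiag then v₀ else 0) =
      if ∀ e ∈ A, (Sym2.map σ e).IsDiag then v₀ ^ #A else 0 := fun σ => by
    split_ifs with h
    · rw [Finset.prod_congr rfl fun e he => if_pos (h e he), Finset.prod_const]
    · push Not at h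
      obtain ⟨e, he, h⟩ := h
      exact Finset.prod_eq_zero he (if_neg h)
  simp only [h]
  rw [← Finset.sum_filter, Finset.sum_const, nsmul_eq_mul, eval_mul, eval_pow, eval_X, eval_C,
    ← Fintype.card_subtype, ← Nat.card_eq_fintype_card, ← Nat.card_eq_fintype_card]
  have := card_fun_constant_on_edges (C := C) (A : Set (Sym2 V))
  simp only [SetLike.mem_coe] at this
  rw [this]
  push_cast
  rfl

theorem pottsWeight_injective_comp {V C D : Type*} [Finite V] [DecidableEq C] [DecidableEq D]
    (v₀ : ℂ) (G : SimpleGraph V) {f : C → D} (hf : f.Injective) (σ : V → C) :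
    pottsWeight v₀ G (f ∘ σ) = pottsWeight v₀ G σ := by
  refine Finset.prod_congr rfl fun e _ => ?_
  rw [← Sym2.map_map]
  simp only [Sym2.isDiag_map hf]

/-- Bichromatic cross edges contribute 1. General embeddings let this serve both disjoint unions,
which have no cross edges, and color splittings, where cross edges join disjoint palettes. -/
theorem pottsWeight_eq_mul {V V₁ V₂ C : Type*} [Finite V] [Finite V₁] [Finite V₂] [DecidableEq C]
    (v₀ : ℂ) (G : SimpleGraph V) (φ₁ : V₁ ↪ V) (φ₂ : V₂ ↪ V)
    (hd : ∀ a b, φ₁ a ≠ φ₂ b) (hc : ∀ v, (∃ a, φ₁ a = v) ∨ ∃ b, φ₂ b = v)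
    (σ : V → C) (hσ : ∀ a b, G.Adj (φ₁ a) (φ₂ b) → σ (φ₁ a) ≠ σ (φ₂ b)) :
    pottsWeight v₀ G σ =
      pottsWeight v₀ (G.comap φ₁) (σ ∘ φ₁) * pottsWeight v₀ (G.comap φ₂) (σ ∘ φ₂) := by
  classical
  have hdisj : Disjoint ((Set.toFinite (G.comap φ₁).edgeSet).toFinset.image (Sym2.map φ₁))
      ((Set.toFinite (G.comap φ₂).edgeSet).toFinset.image (Sym2.map φ₂)) := by
    rw [Finset.disjoint_left]
    rintro e h₁ h₂
    simp only [Finset.mem_image] at h₁ h₂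
    obtain ⟨⟨a, b⟩, -, rfl⟩ := h₁
    obtain ⟨⟨c, d⟩, -, h⟩ := h₂
    have h' : s(φ₂ c, φ₂ d) = s(φ₁ a, φ₁ b) := h
    rw [Sym2.eq_iff] at h'
    rcases h' with h' | h'
    · exact hd _ _ h'.1.symm
    · exact hd _ _ h'.1.symm
  have hsub : (Set.toFinite (G.comap φ₁).edgeSet).toFinset.image (Sym2.map φ₁) ∪
      (Set.toFinite (G.comap φ₂).edgeSet).toFinset.image (Sym2.map φ₂) ⊆
        (Set.toFinite G.edgeSet).toFinset := by
    intro e he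
    simp only [Finset.mem_union, Finset.mem_image, Set.Finite.mem_toFinset] at he ⊢
    rcases he with ⟨⟨a, b⟩, h, rfl⟩ | ⟨⟨a, b⟩, h, rfl⟩ <;> exact h
  simp only [pottsWeight]
  rw [← Finset.prod_subset hsub, Finset.prod_union hdisj,
    Finset.prod_image (Sym2.map.injective φ₁.injective).injOn,
    Finset.prod_image (Sym2.map.injective φ₂.injective).injOn]
  · simp only [Sym2.map_map]
  · intro e he hne
    induction e with
    | _ x y =>
    simp only [Finset.mem_union, Finset.mem_image, Set.Finite.mem_toFinset, not_or,
      SimpleGraph.mem_edgeSet] at he hne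
    rw [if_neg, add_zero]
    rw [Sym2.map_mk, Sym2.mk_isDiag_iff]
    rcases hc x with ⟨a, rfl⟩ | ⟨a, rfl⟩ <;> rcases hc y with ⟨b, rfl⟩ | ⟨b, rfl⟩
    · exact absurd ⟨s(a, b), he, rfl⟩ hne.1
    · exact hσ _ _ he
    · exact (hσ _ _ he.symm).symm
    · exact absurd ⟨s(a, b), he, rfl⟩ hne.2

end Potts

/-! ### Multiplicativity and exponential type. -/

theorem Polynomial.eq_of_forall_eval_natCast_eq {p q : ℂ[X]}
    (h : ∀ n : ℕ, p.eval (n : ℂ) = q.eval (n : ℂ)) : p = q :=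
  eq_of_infinite_eval_eq p q <| (Set.infinite_range_of_injective (f := fun n : ℕ => (n : ℂ))
    Nat.cast_injective).mono <| by rintro _ ⟨n, rfl⟩; exact h n

theorem isMultiplicative_tuttePolynomial (v₀ : ℂ) :
    (tuttePolynomial.{u} v₀).IsMultiplicative := by
  classical
  intro V₁ V₂ _ _ G₁ G₂
  have := Fintype.ofFinite V₁
  have := Fintype.ofFinite V₂
  refine Polynomial.eq_of_forall_eval_natCast_eq fun q => ?_
  have h (W : Type u) [Fintype W] [DecidableEq W] (G : SimpleGraph W) :=
    eval_tuttePolynomial_card (C := Fin q) v₀ G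
  simp only [Fintype.card_fin] at h
  rw [eval_mul, h, h, h, Finset.sum_mul_sum, ← Finset.sum_product',
    Finset.univ_product_univ]
  apply Fintype.sum_equiv (Equiv.sumArrowEquivProdArrow V₁ V₂ (Fin q))
  intro σ
  rw [pottsWeight_eq_mul v₀ _ (Function.Embedding.inl) (Function.Embedding.inr) (by simp)
    (by rintro (a | b) <;> simp) _ (by simp)]
  congr 1

/-- The maps are grouped by the set S of points sent to the left summand. -/
theorem Fintype.sum_fun_to_sum {V α β M : Type*} [Fintype V] [DecidableEq V] [Fintype α] [Fintype β]
    [AddCommMonoid M] (f : (V → α ⊕ β) → M) :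
    ∑ σ, f σ = ∑ S : Finset V, ∑ g : (↥(S : Set V) → α) × (↥(S : Set V)ᶜ → β),
      f fun v => if h : v ∈ S then .inl (g.1 ⟨v, h⟩) else .inr (g.2 ⟨v, h⟩) := by
  classical
  rw [← Finset.sum_fiberwise univ fun σ : V → α ⊕ β => univ.filter fun v => (σ v).isLeft]
  refine Finset.sum_congr rfl fun S _ => (Finset.sum_bij (fun g _ v =>
    if h : v ∈ S then .inl (g.1 ⟨v, h⟩) else .inr (g.2 ⟨v, h⟩)) ?_ ?_ ?_ ?_).symm
  · intro g _
    simp only [Finset.mem_filter, Finset.mem_univ, true_and]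
    ext v
    by_cases h : v ∈ S <;> simp [h]
  · intro g _ g' _ h
    refine Prod.ext (funext fun v => ?_) (funext fun v => ?_)
    · have hv : v.1 ∈ S := v.2
      simpa [hv] using congrFun h v.1
    · have hv : v.1 ∉ S := v.2
      simpa [hv] using congrFun h v.1
  · intro σ hσ
    simp only [Finset.mem_filter, Finset.mem_univ, true_and] at hσ
    have h₁ (v : (S : Set V)) : (σ v.1).isLeft := by
      have : v.1 ∈ S := v.2
      simpa using hσ.symm.subset this
    have h₂ (v : ((S : Set V)ᶜ : Set V)) : (σ v.1).isRight := by
      have : v.1 ∉ S := v.2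
      simpa using fun h => this (hσ.subset h)
    refine ⟨(fun v => (σ v.1).getLeft (h₁ v), fun v => (σ v.1).getRight (h₂ v)),
      Finset.mem_univ _, ?_⟩
    ext1 v
    by_cases h : v ∈ S <;> simp [h]
  · intros
    rfl

theorem sum_eval_tuttePolynomial_natCast (v₀ : ℂ) {V : Type u} [Fintype V] (G : SimpleGraph V)
    (a b : ℕ) :
    ∑ S : Finset V,
        (tuttePolynomial v₀ (S : Set V) (G.induce (S : Set V))).eval (a : ℂ) *
          (tuttePolynomial v₀ ((S : Set V)ᶜ : Set V) (G.induce (S : Set V)ᶜ)).eval (b : ℂ)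
      = (tuttePolynomial v₀ V G).eval (a + b : ℂ) := by
  classical
  have hab := eval_tuttePolynomial_card (C := Fin a ⊕ Fin b) v₀ G
  rw [Fintype.card_sum, Fintype.card_fin, Fintype.card_fin, Nat.cast_add, Fintype.sum_fun_to_sum] at hab
  rw [hab]
  refine Finset.sum_congr rfl fun S _ => ?_
  have ha := eval_tuttePolynomial_card (C := Fin a) v₀ (G.induce (S : Set V))
  have hb := eval_tuttePolynomial_card (C := Fin b) v₀ (G.induce (S : Set V)ᶜ)
  rw [Fintype.card_fin] at ha hb
  rw [ha, hb, Finset.sum_mul_sum, ← Finset.sum_product', Finset.univ_product_univ]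
  refine Finset.sum_congr rfl fun g _ => ?_
  rw [pottsWeight_eq_mul v₀ G (Function.Embedding.subtype (· ∈ (S : Set V)))
    (Function.Embedding.subtype (· ∈ (S : Set V)ᶜ))]
  · rw [← pottsWeight_injective_comp v₀ _ (Sum.inl_injective (β := Fin b)) g.1,
      ← pottsWeight_injective_comp v₀ _ (Sum.inr_injective (α := Fin a)) g.2]
    congr 2
    · ext1 v
      have : v.1 ∈ S := v.2
      simp [this]
    · ext1 v
      have : v.1 ∉ S := v.2
      simp [this]
  · rintro ⟨x, hx⟩ ⟨y, hy⟩ rfl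
    exact hy hx
  · intro v
    by_cases h : v ∈ S
    · exact .inl ⟨⟨v, h⟩, rfl⟩
    · exact .inr ⟨⟨v, h⟩, rfl⟩
  · rintro ⟨x, hx⟩ ⟨y, hy⟩ -
    have hx : x ∈ S := hx
    have hy : y ∉ S := hy
    simp [hx, hy]

theorem isExponentialType_tuttePolynomial (v₀ : ℂ) :
    (tuttePolynomial.{u} v₀).IsExponentialType where
  map_empty V _ _ G := by
    have : (Set.toFinite G.edgeSet).toFinset = ∅ := by
      ext ⟨a, _⟩
      exact isEmptyElim a
    rw [tuttePolynomial, this]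
    have : IsEmpty (SimpleGraph.fromEdgeSet
        ((∅ : Finset (Sym2 V)) : Set (Sym2 V))).ConnectedComponent := Quot.instIsEmpty
    simp only [Finset.powerset_empty, Finset.sum_singleton, Finset.card_empty, pow_zero, map_one,
      mul_one, Nat.card_of_isEmpty]
  sum_eq V _ G x y := by
    -- The identity is freed one variable at a time: first x with y = b a natural number, then y
    -- with x an arbitrary complex number.
    have h₁ (b : ℕ) (x : ℂ) :
        ∑ S : Finset V,
          (tuttePolynomial v₀ (S : Set V) (G.induce (S : Set V))).eval x *
            (tuttePolynomial v₀ ((S : Set V)ᶜ : Set V) (G.induce (S : Set V)ᶜ)).eval (b : ℂ)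
        = (tuttePolynomial v₀ V G).eval (x + b) := by
      have : ∑ S : Finset V, tuttePolynomial v₀ (S : Set V) (G.induce (S : Set V)) *
          C ((tuttePolynomial v₀ ((S : Set V)ᶜ : Set V) (G.induce (S : Set V)ᶜ)).eval (b : ℂ))
          = (tuttePolynomial v₀ V G).comp (X + C (b : ℂ)) :=
        Polynomial.eq_of_forall_eval_natCast_eq fun a => by
          simpa [eval_finsetSum] using sum_eval_tuttePolynomial_natCast v₀ G a b
      simpa [eval_finsetSum] using congrArg (eval x) this
    have : ∑ S : Finset V, C ((tuttePolynomial v₀ (S : Set V) (G.induce (S : Set V))).eval x) *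
        tuttePolynomial v₀ ((S : Set V)ᶜ : Set V) (G.induce (S : Set V)ᶜ)
        = (tuttePolynomial v₀ V G).comp (C x + X) :=
      Polynomial.eq_of_forall_eval_natCast_eq fun b => by
        simpa [eval_finsetSum] using h₁ b x
    simpa [eval_finsetSum] using congrArg (eval y) this

/-! ### Leading term, and the chromatic polynomial as a specialisation. -/

theorem isMonic_tuttePolynomial (v₀ : ℂ) : (tuttePolynomial.{u} v₀).IsMonic := by
  classical
  intro V _ G
  have := Fintype.ofFinite V
  have h₀ : Nat.card (SimpleGraph.fromEdgeSet
      ((∅ : Finset (Sym2 V)) : Set (Sym2 V))).ConnectedComponent = Nat.card V := by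
    refine (Nat.card_eq_of_bijective (SimpleGraph.connectedComponentMk _) ⟨fun a b h => ?_,
      Quot.mk_surjective⟩).symm
    simpa using SimpleGraph.ConnectedComponent.exact h
  -- Any edge merges two vertices, so only A = ∅ reaches |V| components.
  have hdeg : (∑ A ∈ (Set.toFinite G.edgeSet).toFinset.powerset.erase ∅,
      (X ^ Nat.card (SimpleGraph.fromEdgeSet (A : Set (Sym2 V))).ConnectedComponent *
        C (v₀ ^ #A) : ℂ[X])).degree < (Nat.card V : WithBot ℕ) := by
    rw [← Polynomial.mem_degreeLT]
    refine Submodule.sum_mem _ fun A hA => Polynomial.mem_degreeLT.2 ?_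
    rw [Finset.mem_erase, Finset.mem_powerset, ← Finset.nonempty_iff_ne_empty] at hA
    obtain ⟨⟨e, he⟩, hA⟩ := hA
    have hlt : Nat.card (SimpleGraph.fromEdgeSet (A : Set (Sym2 V))).ConnectedComponent
        < Nat.card V := by
      have := Fintype.ofFinite (SimpleGraph.fromEdgeSet (A : Set (Sym2 V))).ConnectedComponent
      rw [Nat.card_eq_fintype_card, Nat.card_eq_fintype_card]
      refine Fintype.card_lt_of_surjective_not_injective (SimpleGraph.connectedComponentMk _)
        Quot.mk_surjective fun hinj => ?_
      induction e with
      | _ a b =>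
      have hab : G.Adj a b := by simpa using hA he
      exact hab.ne (hinj (SimpleGraph.ConnectedComponent.sound (SimpleGraph.Adj.reachable
        ((SimpleGraph.fromEdgeSet_adj _).2 ⟨he, hab.ne⟩))))
    rw [mul_comm]
    exact (degree_C_mul_X_pow_le _ _).trans_lt (by exact_mod_cast hlt)
  have heq : tuttePolynomial v₀ V G = X ^ Nat.card V +
      ∑ A ∈ (Set.toFinite G.edgeSet).toFinset.powerset.erase ∅,
      (X ^ Nat.card (SimpleGraph.fromEdgeSet (A : Set (Sym2 V))).ConnectedComponent *
        C (v₀ ^ #A) : ℂ[X]) := by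
    rw [tuttePolynomial, ← Finset.add_sum_erase _ _ (Finset.empty_mem_powerset _), h₀]
    simp
  rw [heq]
  exact ⟨monic_X_pow_add hdeg, natDegree_eq_of_degree_eq_some <| by
    rw [degree_add_eq_left_of_degree_lt (by rwa [degree_X_pow]), degree_X_pow]⟩

theorem chromaticPolynomial_eq_tuttePolynomial :
    chromaticPolynomial.{u} = tuttePolynomial.{u} (-1) := by
  classical
  funext V _ G
  refine (existsUnique_countsColorings G).unique
    (existsUnique_countsColorings G).choose_spec.1 fun q _ => ?_
  have := Fintype.ofFinite V
  have h := eval_tuttePolynomial_card (C := Fin q) (-1) G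
  rw [Fintype.card_fin] at h
  have hw (σ : V → Fin q) : pottsWeight (-1) G σ =
      if ∀ a b, G.Adj a b → σ a ≠ σ b then 1 else 0 := by
    split_ifs with hσ
    · refine Finset.prod_eq_one fun e he => ?_
      induction e with
      | _ a b =>
        rw [if_neg (by simpa using hσ a b (by simpa using he)), add_zero]
    · push Not at hσ
      obtain ⟨a, b, hab, hσ⟩ := hσ
      refine Finset.prod_eq_zero (i := s(a, b)) (by simpa using hab) ?_
      rw [if_pos (by simpa using hσ), add_neg_cancel]
  rw [h, Finset.sum_congr rfl fun σ _ => hw σ, Finset.sum_boole, ← Fintype.card_subtype,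
    ← Nat.card_eq_fintype_card]
  congr 1
  exact Nat.card_congr
    { toFun := fun σ => SimpleGraph.Coloring.mk σ.1 fun {a b} h => σ.2 a b h
      invFun := fun c => ⟨c, fun a b h => c.valid h⟩
      left_inv := fun _ => rfl
      right_inv := fun _ => rfl }

/-! ### Tree coefficients and the domination of rooted weights. -/

section TreeBound

/-- The coefficient of `z ^ n` in `exp (d * T)`, where `T = z * exp (Δ * T)`. -/
noncomputable def treeBound (Δ d : ℕ) : ℕ → ℝ
  | 0 => 1
  | n + 1 => d * (d + Δ * (n + 1)) ^ n / (n + 1).factorial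

theorem treeBound_nonneg (Δ d n : ℕ) : 0 ≤ treeBound Δ d n := by
  cases n <;> simp only [treeBound] <;> positivity

theorem treeBound_mono (Δ n : ℕ) {d d' : ℕ} (h : d ≤ d') : treeBound Δ d n ≤ treeBound Δ d' n := by
  cases n <;> simp only [treeBound]
  · exact le_rfl
  · gcongr

/-- This is the coefficient form of exp(dT) + z exp((d + Δ)T) = exp(dT)(1 + T) ≤ exp((d + 1)T). With
the closed form it reduces to a Bernoulli-type inequality in y = d + Δ(n + 1). -/
theorem treeBound_add_le (Δ d n : ℕ) :
    treeBound Δ d (n + 1) + treeBound Δ (d + Δ) n ≤ treeBound Δ (d + 1) (n + 1) := by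
  cases n with
  | zero => simp [treeBound]
  | succ m =>
    simp only [treeBound]
    have hf : ((m + 1 + 1).factorial : ℝ) = (m + 2) * (m + 1).factorial := by
      rw [Nat.factorial_succ (m + 1)]
      push_cast
      ring
    have hpos : (0 : ℝ) < (m + 1).factorial := by exact_mod_cast Nat.factorial_pos _
    rw [hf]
    push_cast
    have hy₀ : (0 : ℝ) ≤ d + Δ * (m + 1 + 1) := by positivity
    have hmul : ((d + Δ : ℕ) : ℝ) * (m + 2) = (m + 1) * d + (d + Δ * (m + 1 + 1)) := by
      push_cast
      ring
    have hy : ((d : ℝ) + Δ + Δ * (m + 1)) = d + Δ * (m + 1 + 1) := by ring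
    have hy' : ((d : ℝ) + 1 + Δ * (m + 1 + 1)) = d + Δ * (m + 1 + 1) + 1 := by ring
    rw [hy, hy']
    generalize (d : ℝ) + Δ * (m + 1 + 1) = y at *
    push_cast at hmul
    have hb : y ^ (m + 1) + (m + 1) * y ^ m ≤ (y + 1) ^ (m + 1) := by
      clear hmul hy hy' hf
      induction m with
      | zero => simp
      | succ m ih =>
        have := mul_le_mul_of_nonneg_right (ih (by exact_mod_cast Nat.factorial_pos _))
          (by positivity : 0 ≤ y + 1)
        have h₂ : 0 ≤ y ^ m := by positivity
        push_cast
        rw [pow_succ (y + 1) (m + 1)]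
        refine le_trans ?_ this
        ring_nf
        nlinarith
    rw [← sub_nonneg]
    have : ((d : ℝ) + 1) * (y + 1) ^ (m + 1) / ((m + 2) * (m + 1).factorial) -
        (d * y ^ (m + 1) / ((m + 2) * (m + 1).factorial) + (d + Δ) * y ^ m / (m + 1).factorial) =
        ((d + 1) * (y + 1) ^ (m + 1) - d * y ^ (m + 1) - ((d + Δ) * (m + 2)) * y ^ m) /
          ((m + 2) * (m + 1).factorial) := by
      field_simp
      ring
    rw [this, hmul]
    refine div_nonneg ?_ (by positivity)
    have h₁ := mul_le_mul_of_nonneg_left hb (by positivity : (0 : ℝ) ≤ d + 1)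
    have h₂ : 0 ≤ ((m : ℝ) + 1) * y ^ m := by positivity
    rw [pow_succ y m] at *
    nlinarith

/-- One term of the exponential series gives (m+2)^(m+1)/(m+1)! ≤ e^(m+2); dividing by m + 2 gains a
factor e once m ≥ 1, as e < 3. -/
theorem treeBound_self_le (Δ n : ℕ) : treeBound Δ Δ n ≤ (Real.exp 1 * Δ) ^ n := by
  cases n with
  | zero => simp [treeBound]
  | succ m =>
    have key : ((m : ℝ) + 2) ^ m / (m + 1).factorial ≤ Real.exp 1 ^ (m + 1) := by
      rcases Nat.eq_zero_or_pos m with rfl | hm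
      · simp
      have h := Real.pow_div_factorial_le_exp ((m + 2 : ℕ) : ℝ) (by positivity) (m + 1)
      rw [← Real.exp_one_pow, pow_succ (Real.exp 1), pow_succ, mul_div_right_comm] at h
      push_cast at h
      have hm' : (1 : ℝ) ≤ m := by exact_mod_cast hm
      refine le_of_mul_le_mul_right (h.trans ?_) (by positivity : (0 : ℝ) < m + 2)
      gcongr
      linarith [Real.exp_one_lt_d9]
    calc treeBound Δ Δ (m + 1) = Δ ^ (m + 1) * (((m : ℝ) + 2) ^ m / (m + 1).factorial) := by
          simp only [treeBound]
          rw [show (Δ : ℝ) + Δ * (m + 1) = Δ * (m + 2) by ring, mul_pow]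
          ring
      _ ≤ Δ ^ (m + 1) * Real.exp 1 ^ (m + 1) := by gcongr
      _ = _ := by rw [mul_pow]; ring

end TreeBound

/-- A weight `p U S` which, when a root `u ∈ U` is removed, is bounded by the sum of the weights in
which some of the neighbors of `u` become roots, is dominated by a count of rooted forests. -/
theorem sum_rooted_le_treeBound {V : Type*} [Fintype V] [DecidableEq V] (G : SimpleGraph V)
    [DecidableRel G.Adj] {Δ : ℕ} (hΔ : ∀ w, G.degree w ≤ Δ) (p : Finset V → Finset V → ℝ)
    (hp₀ : ∀ U S, 0 ≤ p U S) (hp_empty : p ∅ ∅ ≤ 1) (hp_nonempty : ∀ S, S.Nonempty → p ∅ S ≤ 0)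
    (hp : ∀ u U S, u ∈ U → U ⊆ S →
      p U S ≤ ∑ B ∈ (G.neighborFinset u ∩ (S \ U)).powerset, p (U.erase u ∪ B) (S.erase u))
    (N : ℕ) (L K : Finset V) (hKL : Disjoint K L) (hK : #K ≤ N) :
    ∑ B ∈ L.powerset, ∑ S : Finset V with K ∪ B ⊆ S ∧ #S = N, p (K ∪ B) S ≤
      treeBound Δ (#L + Δ * #K) (N - #K) := by
  induction N generalizing L K with
  | zero =>
    obtain rfl : K = ∅ := by simpa using hK
    simp only [Finset.card_empty, Nat.sub_zero, treeBound, Finset.empty_union]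
    refine le_trans (Finset.sum_le_sum (g := fun B => if B = ∅ then 1 else 0) fun B _ => ?_)
      (by simp)
    split_ifs with h
    · subst h
      simpa [Finset.filter_eq'] using hp_empty
    · refine (Finset.sum_eq_zero fun S hS => ?_).le
      simp only [Finset.mem_filter, Finset.mem_univ, true_and, Finset.card_eq_zero] at hS
      exact absurd (Finset.subset_empty.1 (hS.2 ▸ hS.1)) h
  | succ N ihN =>
    -- K holds the compulsory roots and L the optional ones. When L is empty, a root u of K is
    -- deleted and its neighbors outside K become the new L; otherwise one w ∈ L is either discarded
    -- or moved to K, matching the two terms of `treeBound_add_le`.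
    induction L using Finset.induction_on generalizing K with
    | empty =>
      simp only [Finset.powerset_empty, Finset.sum_singleton, Finset.union_empty,
        Finset.card_empty, zero_add]
      rcases K.eq_empty_or_nonempty with rfl | ⟨u, hu⟩
      · refine (Finset.sum_nonpos fun S hS => hp_nonempty S ?_).trans (treeBound_nonneg _ _ _)
        simp only [Finset.mem_filter, Finset.mem_univ, true_and] at hS
        rw [← Finset.card_pos, hS.2]
        exact N.succ_pos
      have hcard := Finset.card_erase_add_one hu
      calc ∑ S : Finset V with K ⊆ S ∧ #S = N + 1, p K S
          ≤ ∑ S : Finset V with K ⊆ S ∧ #S = N + 1,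
              ∑ B ∈ (G.neighborFinset u ∩ (S \ K)).powerset, p (K.erase u ∪ B) (S.erase u) :=
            Finset.sum_le_sum fun S hS => hp u K S hu (Finset.mem_filter.1 hS).2.1
        _ = ∑ B ∈ (G.neighborFinset u \ K).powerset,
              ∑ S : Finset V with K ∪ B ⊆ S ∧ #S = N + 1, p (K.erase u ∪ B) (S.erase u) := by
            refine Finset.sum_comm' fun S B => ?_
            simp only [Finset.mem_filter, Finset.mem_univ, true_and, Finset.mem_powerset,
              Finset.subset_iff, Finset.mem_inter, Finset.mem_sdiff, Finset.mem_union]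
            grind
        _ ≤ ∑ B ∈ (G.neighborFinset u \ K).powerset,
              ∑ S : Finset V with K.erase u ∪ B ⊆ S ∧ #S = N, p (K.erase u ∪ B) S := by
            -- Every S here contains u, so S ↦ S \ {u} is injective; enlarging its image only adds
            -- nonnegative terms.
            refine Finset.sum_le_sum fun B hB => ?_
            have huB : u ∉ B := fun h => (Finset.mem_sdiff.1 (Finset.mem_powerset.1 hB h)).2 hu
            rw [← Finset.sum_image (g := fun S : Finset V => S.erase u)
              (f := fun S => p (K.erase u ∪ B) S)]
            · refine Finset.sum_le_sum_of_subset_of_nonneg ?_ fun _ _ _ => hp₀ _ _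
              intro T hT
              simp only [Finset.mem_image, Finset.mem_filter, Finset.mem_univ, true_and] at hT ⊢
              obtain ⟨S, ⟨hS, hSN⟩, rfl⟩ := hT
              have huS : u ∈ S := hS (Finset.mem_union_left _ hu)
              refine ⟨?_, by rw [Finset.card_erase_of_mem huS, hSN, Nat.add_sub_cancel]⟩
              intro x hx
              have : x ≠ u := by rintro rfl; simp [huB] at hx
              refine Finset.mem_erase.2 ⟨this, hS ?_⟩
              simp only [Finset.mem_union, Finset.mem_erase] at hx ⊢
              exact hx.imp_left And.right
            · intro S hS T hT h
              simp only [Finset.coe_filter, Finset.mem_univ, true_and, Set.mem_ofPred_eq] at hS hT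
              rw [← Finset.insert_erase (hS.1 (Finset.mem_union_left _ hu)),
                ← Finset.insert_erase (hT.1 (Finset.mem_union_left _ hu))]
              exact congrArg _ h
        _ ≤ treeBound Δ (#(G.neighborFinset u \ K) + Δ * #(K.erase u)) (N - #(K.erase u)) :=
            ihN _ _ (Finset.disjoint_sdiff.mono_left (Finset.erase_subset _ _)) (by omega)
        _ ≤ treeBound Δ (Δ * #K) (N + 1 - #K) := by
            rw [show N + 1 - #K = N - #(K.erase u) by omega]
            refine treeBound_mono _ _ ?_
            rw [← hcard, mul_add, mul_one, add_comm]
            refine Nat.add_le_add_left ((Finset.card_le_card Finset.sdiff_subset).trans ?_) _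
            rw [SimpleGraph.card_neighborFinset_eq_degree]
            exact hΔ u
    | insert w L hw ihL =>
      have hwK : w ∉ K := fun h => Finset.disjoint_left.1 hKL h (Finset.mem_insert_self _ _)
      have hKL' : Disjoint K L := hKL.mono_right (Finset.subset_insert _ _)
      rw [Finset.sum_powerset_insert hw, Finset.card_insert_of_notMem hw]
      have hunion (B : Finset V) : K ∪ insert w B = insert w K ∪ B := by
        ext; simp
      simp only [hunion]
      -- If K already has N + 1 elements, no S has room for w, and the terms with w vanish.
      rcases hK.eq_or_lt with hK | hK
      · have hzero : ∑ B ∈ L.powerset, ∑ S : Finset V with insert w K ∪ B ⊆ S ∧ #S = N + 1,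
            p (insert w K ∪ B) S = 0 := by
          refine Finset.sum_eq_zero fun B _ => ?_
          rw [Finset.filter_eq_empty_iff.2, Finset.sum_empty]
          rintro S - ⟨hS, hSN⟩
          have := Finset.card_le_card (Finset.subset_union_left.trans hS)
          rw [Finset.card_insert_of_notMem hwK] at this
          omega
        rw [hzero, add_zero]
        exact (ihL K hKL' hK.le).trans (treeBound_mono _ _ (by omega))
      · have h₁ := ihL K hKL' hK.le
        have h₂ := ihL (insert w K) (by simp [hw, hKL'])
          (by rwa [Finset.card_insert_of_notMem hwK])
        rw [Finset.card_insert_of_notMem hwK] at h₂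
        obtain ⟨n, hn⟩ : ∃ n, N + 1 - #K = n + 1 := ⟨N - #K, by omega⟩
        have h₃ := treeBound_add_le Δ (#L + Δ * #K) n
        rw [hn] at h₁ ⊢
        rw [show N + 1 - (#K + 1) = n by omega,
          show #L + Δ * (#K + 1) = #L + Δ * #K + Δ by ring] at h₂
        rw [show #L + 1 + Δ * #K = #L + Δ * #K + 1 by ring]
        linarith

/-! ### Rooted edge sums and their recursion. -/

theorem Finset.sum_powerset_union_of_disjoint {α M : Type*} [DecidableEq α] [AddCommMonoid M]
    {s t : Finset α} (h : Disjoint s t) (f : Finset α → M) :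
    ∑ A ∈ (s ∪ t).powerset, f A = ∑ A ∈ s.powerset, ∑ B ∈ t.powerset, f (A ∪ B) := by
  induction t using Finset.induction_on generalizing f with
  | empty => simp
  | insert a t ha ih =>
    rw [Finset.disjoint_insert_right] at h
    rw [Finset.union_insert, Finset.sum_powerset_insert (by simp [h.1, ha]), ih h.2, ih h.2,
      ← Finset.sum_add_distrib]
    refine Finset.sum_congr rfl fun A _ => ?_
    simp only [Finset.sum_powerset_insert ha, Finset.union_insert]

theorem Finset.sum_powerset_image {α β M : Type*} [DecidableEq β] [AddCommMonoid M]
    {φ : α → β} (hφ : φ.Injective) (s : Finset α) (f : Finset β → M) :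
    ∑ A ∈ (s.image φ).powerset, f A = ∑ A ∈ s.powerset, f (A.image φ) := by
  rw [Finset.powerset_image, Finset.sum_image (Finset.image_injective hφ).injOn]

/-- The edges of `G` with both ends in `S`. -/
noncomputable def edgesWithin {V : Type*} [Finite V] (G : SimpleGraph V) (S : Finset V) :
    Finset (Sym2 V) :=
  (Set.toFinite {e | e ∈ G.edgeSet ∧ ∀ x ∈ e, x ∈ S}).toFinset

theorem mk_mem_edgesWithin {V : Type*} [Finite V] {G : SimpleGraph V} {S : Finset V} {a b : V} :
    s(a, b) ∈ edgesWithin G S ↔ G.Adj a b ∧ a ∈ S ∧ b ∈ S := by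
  simp [edgesWithin]

/-- Every vertex in `S` is joined by a path with edges in `A` to a vertex in `U`. -/
def ReachesRoot {V : Type*} (A : Finset (Sym2 V)) (U S : Finset V) : Prop :=
  ∀ x ∈ S, ∃ y ∈ U, (SimpleGraph.fromEdgeSet (A : Set (Sym2 V))).Reachable x y

open Classical in
/-- The sum of `v₀ ^ #A` over the edge sets `A` in `G[S]` such that every component of `(S, A)`
contains a vertex in `U`. -/
noncomputable def rootedSum {V : Type*} [Finite V] (v₀ : ℂ) (G : SimpleGraph V) (U S : Finset V) :
    ℂ :=
  ∑ A ∈ (edgesWithin G S).powerset with ReachesRoot A U S, v₀ ^ #A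

theorem rootedSum_empty_empty {V : Type*} [Finite V] (v₀ : ℂ) (G : SimpleGraph V) :
    rootedSum v₀ G ∅ ∅ = 1 := by
  have : edgesWithin G ∅ = ∅ := by
    ext ⟨a, b⟩
    exact mk_mem_edgesWithin.trans (by simp)
  classical
  rw [rootedSum, this, Finset.powerset_empty, Finset.filter_singleton,
    if_pos (by simp [ReachesRoot])]
  simp

theorem rootedSum_empty_of_nonempty {V : Type*} [Finite V] (v₀ : ℂ) (G : SimpleGraph V)
    {S : Finset V} (hS : S.Nonempty) : rootedSum v₀ G ∅ S = 0 := by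
  classical
  obtain ⟨x, hx⟩ := hS
  refine Finset.sum_eq_zero fun A hA => ?_
  obtain ⟨y, hy, -⟩ := (Finset.mem_filter.1 hA).2 x hx
  exact absurd hy (Finset.notMem_empty y)

theorem edgesWithin_eq_union {V : Type*} [Fintype V] [DecidableEq V] (G : SimpleGraph V)
    [DecidableRel G.Adj] {u : V} {S : Finset V} (hu : u ∈ S) :
    edgesWithin G S =
      edgesWithin G (S.erase u) ∪ (G.neighborFinset u ∩ S).image (fun w => s(u, w)) := by
  ext e
  induction e with
  | _ a b =>
    simp only [Finset.mem_union, mk_mem_edgesWithin, Finset.mem_erase, Finset.mem_image,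
      Finset.mem_inter, SimpleGraph.mem_neighborFinset, Sym2.eq_iff]
    constructor
    · rintro ⟨hab, ha, hb⟩
      by_cases hau : a = u
      · subst hau
        exact .inr ⟨b, ⟨hab, hb⟩, .inl ⟨rfl, rfl⟩⟩
      by_cases hbu : b = u
      · subst hbu
        exact .inr ⟨a, ⟨hab.symm, ha⟩, .inr ⟨rfl, rfl⟩⟩
      exact .inl ⟨hab, ⟨hau, ha⟩, hbu, hb⟩
    · rintro (⟨hab, ⟨-, ha⟩, -, hb⟩ | ⟨w, ⟨huw, hw⟩, ⟨rfl, rfl⟩ | ⟨rfl, rfl⟩⟩)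
      · exact ⟨hab, ha, hb⟩
      · exact ⟨huw, hu, hw⟩
      · exact ⟨huw.symm, hw, hu⟩

theorem notMem_of_mem_edgesWithin_erase {V : Type*} [Finite V] [DecidableEq V] {G : SimpleGraph V}
    {u : V} {S : Finset V} {e : Sym2 V} (he : e ∈ edgesWithin G (S.erase u)) : u ∉ e := by
  simp only [edgesWithin, Set.Finite.mem_toFinset, Set.mem_ofPred_eq] at he
  exact fun h => by simpa using he.2 u h

/-- A path to a root either avoids u, or reaches u through some vertex of B, which is now itself a
root. Conversely, a path ending in B is prolonged by one edge to u. -/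
theorem reachesRoot_union_star {V : Type*} [DecidableEq V] {u : V} {U S : Finset V}
    (hu : u ∈ U) {A : Finset (Sym2 V)} (hA : ∀ e ∈ A, u ∉ e) {B : Finset V}
    (hB : u ∉ B) :
    ReachesRoot (A ∪ B.image fun w => s(u, w)) U S ↔
      ReachesRoot A (U.erase u ∪ B) (S.erase u) := by
  have hle : SimpleGraph.fromEdgeSet (A : Set (Sym2 V)) ≤
      SimpleGraph.fromEdgeSet ((A ∪ B.image fun w => s(u, w) : Finset (Sym2 V)) : Set (Sym2 V)) :=
    SimpleGraph.fromEdgeSet_mono (by simp)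
  constructor
  · intro h x hx
    rw [Finset.mem_erase] at hx
    obtain ⟨y, hy, hxy⟩ := h x hx.2
    replace hx := hx.1
    rw [SimpleGraph.reachable_iff_reflTransGen] at hxy
    induction hxy using Relation.ReflTransGen.head_induction_on with
    | refl => exact ⟨y, by simp [hx, hy], .refl _⟩
    | @head a c hac _ ih =>
      simp only [SimpleGraph.fromEdgeSet_adj, Finset.coe_union, Set.mem_union, SetLike.mem_coe,
        Finset.mem_image, Sym2.eq_iff] at hac
      obtain ⟨hac | ⟨w, hw, ⟨rfl, rfl⟩ | ⟨rfl, rfl⟩⟩, hne⟩ := hac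
      · have hc : c ≠ u := by
          rintro rfl
          exact hA _ hac (Sym2.mem_mk_right _ _)
        obtain ⟨z, hz, hcz⟩ := ih hc
        exact ⟨z, hz, .trans (SimpleGraph.Adj.reachable
          ((SimpleGraph.fromEdgeSet_adj _).2 ⟨hac, hne⟩)) hcz⟩
      · exact absurd rfl hx
      · exact ⟨w, by simp [hw], .refl _⟩
  · intro h x hx
    by_cases hxu : x = u
    · exact ⟨u, hu, hxu ▸ .refl _⟩
    obtain ⟨y, hy, hxy⟩ := h x (Finset.mem_erase.2 ⟨hxu, hx⟩)
    rw [Finset.mem_union, Finset.mem_erase] at hy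
    rcases hy with hy | hy
    · exact ⟨y, hy.2, hxy.mono hle⟩
    · refine ⟨u, hu, (hxy.mono hle).trans (SimpleGraph.Adj.reachable
        ((SimpleGraph.fromEdgeSet_adj _).2 ⟨?_, fun h => hB (h ▸ hy)⟩))⟩
      simp only [Finset.coe_union, Set.mem_union, SetLike.mem_coe, Finset.mem_image]
      exact .inr ⟨y, hy, Sym2.eq_swap⟩

/-- An edge set in G[S] is an edge set in G[S \ {u}] together with a star from u to B. -/
theorem rootedSum_eq_sum_powerset {V : Type*} [Fintype V] [DecidableEq V] (v₀ : ℂ)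
    (G : SimpleGraph V) [DecidableRel G.Adj] {u : V} {U S : Finset V} (hu : u ∈ U) (hUS : U ⊆ S) :
    rootedSum v₀ G U S = ∑ B ∈ (G.neighborFinset u ∩ S).powerset,
      v₀ ^ #B * rootedSum v₀ G (U.erase u ∪ B) (S.erase u) := by
  classical
  have hinj : Function.Injective fun w : V => s(u, w) :=
    fun _ _ h => Sym2.congr_right.1 h
  have hdisj {A : Finset (Sym2 V)} (hA : A ⊆ edgesWithin G (S.erase u)) (B : Finset V) :
      Disjoint A (B.image fun w => s(u, w)) := by
    rw [Finset.disjoint_left]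
    intro e he he'
    obtain ⟨w, -, rfl⟩ := Finset.mem_image.1 he'
    exact notMem_of_mem_edgesWithin_erase (hA he) (Sym2.mem_mk_left _ _)
  simp only [rootedSum, Finset.sum_filter, Finset.mul_sum]
  rw [edgesWithin_eq_union G (hUS hu), Finset.sum_powerset_union_of_disjoint (hdisj subset_rfl _),
    Finset.sum_comm, Finset.sum_powerset_image hinj]
  refine Finset.sum_congr rfl fun B hB => Finset.sum_congr rfl fun A hA => ?_
  rw [Finset.mem_powerset] at hA hB
  have hiff := reachesRoot_union_star (S := S) hu (A := A) (B := B)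
    (fun e he => notMem_of_mem_edgesWithin_erase (hA he)) (fun h => by simpa using hB h)
  rw [Finset.card_union_of_disjoint (hdisj hA B), Finset.card_image_of_injective _ hinj]
  simp only [hiff]
  split_ifs
  · rw [pow_add, mul_comm]
  · rw [mul_zero]

/-- An edge from `u` to another root does not matter for reaching a root, so that it contributes a
factor `1 + v₀`. -/
theorem rootedSum_eq_mul_sum {V : Type*} [Fintype V] [DecidableEq V] (v₀ : ℂ)
    (G : SimpleGraph V) [DecidableRel G.Adj] {u : V} {U S : Finset V} (hu : u ∈ U) (hUS : U ⊆ S) :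
    rootedSum v₀ G U S = (1 + v₀) ^ #(G.neighborFinset u ∩ U) *
      ∑ B ∈ (G.neighborFinset u ∩ (S \ U)).powerset,
        v₀ ^ #B * rootedSum v₀ G (U.erase u ∪ B) (S.erase u) := by
  have hdisj : Disjoint (G.neighborFinset u ∩ U) (G.neighborFinset u ∩ (S \ U)) :=
    Finset.disjoint_sdiff.mono Finset.inter_subset_right Finset.inter_subset_right
  have hunion : G.neighborFinset u ∩ S =
      (G.neighborFinset u ∩ U) ∪ (G.neighborFinset u ∩ (S \ U)) := by
    rw [← Finset.inter_union_distrib_left, Finset.union_sdiff_of_subset hUS]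
  have hpow : (1 + v₀) ^ #(G.neighborFinset u ∩ U) =
      ∑ A ∈ (G.neighborFinset u ∩ U).powerset, v₀ ^ #A := by
    simpa using Finset.prod_one_add (f := fun _ => v₀) (G.neighborFinset u ∩ U)
  rw [rootedSum_eq_sum_powerset v₀ G hu hUS, hunion, Finset.sum_powerset_union_of_disjoint hdisj,
    hpow, Finset.sum_mul_sum]
  refine Finset.sum_congr rfl fun A hA => Finset.sum_congr rfl fun B hB => ?_
  rw [Finset.mem_powerset] at hA hB
  have hset : U.erase u ∪ (A ∪ B) = U.erase u ∪ B := by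
    rw [← Finset.union_assoc, (Finset.union_eq_left (s := U.erase u) (t := A)).2]
    intro x hx
    have := hA hx
    rw [Finset.mem_inter, SimpleGraph.mem_neighborFinset] at this
    exact Finset.mem_erase.2 ⟨this.1.ne', this.2⟩
  rw [hset, Finset.card_union_of_disjoint (hdisj.mono hA hB), pow_add, mul_assoc]

/-- With a single root the condition is connectedness: edges of the image join vertices of S only,
so paths starting in S stay there. -/
theorem reachesRoot_image_val_iff {V : Type*} [DecidableEq V] {S : Finset V} {v : V} (hv : v ∈ S)
    (A : Finset (Sym2 (S : Set V))) :
    ReachesRoot (A.image (Sym2.map Subtype.val)) {v} S ↔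
      Nat.card (SimpleGraph.fromEdgeSet (A : Set (Sym2 (S : Set V)))).ConnectedComponent = 1 := by
  have hadj {a b : V} : (SimpleGraph.fromEdgeSet
      ((A.image (Sym2.map Subtype.val) : Finset (Sym2 V)) : Set (Sym2 V))).Adj a b ↔
      ∃ (ha : a ∈ S) (hb : b ∈ S),
        (SimpleGraph.fromEdgeSet (A : Set (Sym2 (S : Set V)))).Adj ⟨a, ha⟩ ⟨b, hb⟩ := by
    simp only [SimpleGraph.fromEdgeSet_adj, SetLike.mem_coe, Finset.mem_image]
    constructor
    · rintro ⟨⟨⟨⟨c, hc⟩, ⟨d, hd⟩⟩, he, h⟩, hne⟩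
      have h' : s(c, d) = s(a, b) := h
      rw [Sym2.eq_iff] at h'
      obtain ⟨rfl, rfl⟩ | ⟨rfl, rfl⟩ := h'
      · exact ⟨hc, hd, he, by simpa using hne⟩
      · exact ⟨hd, hc, Sym2.eq_swap ▸ he, by simpa using hne⟩
    · rintro ⟨ha, hb, h, hne⟩
      exact ⟨⟨_, h, rfl⟩, by simpa using hne⟩
  have hreach {a b : V} (ha : a ∈ S) (hb : b ∈ S) : (SimpleGraph.fromEdgeSet
      ((A.image (Sym2.map Subtype.val) : Finset (Sym2 V)) : Set (Sym2 V))).Reachable a b ↔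
      (SimpleGraph.fromEdgeSet (A : Set (Sym2 (S : Set V)))).Reachable ⟨a, ha⟩ ⟨b, hb⟩ := by
    constructor
    · intro h
      rw [SimpleGraph.reachable_iff_reflTransGen] at h
      induction h using Relation.ReflTransGen.head_induction_on with
      | refl => exact .refl _
      | head hac _ ih =>
        obtain ⟨_, hc, hac⟩ := hadj.1 hac
        exact hac.reachable.trans (ih hc)
    · exact fun h => h.map ⟨Subtype.val, fun {x y} h => hadj.2 ⟨x.2, y.2, h⟩⟩
  rw [Nat.card_eq_one_iff_exists]
  constructor
  · refine fun h => ⟨SimpleGraph.connectedComponentMk _ ⟨v, hv⟩, fun c => ?_⟩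
    induction c using SimpleGraph.ConnectedComponent.ind with
    | _ x =>
    obtain ⟨y, hy, hxy⟩ := h x.1 x.2
    obtain rfl := Finset.mem_singleton.1 hy
    exact SimpleGraph.ConnectedComponent.sound ((hreach x.2 hv).1 hxy)
  · rintro ⟨c, hc⟩ x hx
    refine ⟨v, Finset.mem_singleton_self v, (hreach hx hv).2
      (SimpleGraph.ConnectedComponent.exact ?_)⟩
    rw [hc (SimpleGraph.connectedComponentMk _ ⟨x, hx⟩),
      hc (SimpleGraph.connectedComponentMk _ ⟨v, hv⟩)]

theorem coeff_one_tuttePolynomial_induce {V : Type u} [Finite V] (v₀ : ℂ) (G : SimpleGraph V)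
    {S : Finset V} {v : V} (hv : v ∈ S) :
    (tuttePolynomial v₀ (S : Set V) (G.induce (S : Set V))).coeff 1 = rootedSum v₀ G {v} S := by
  classical
  have hedges : edgesWithin G S =
      (Set.toFinite (G.induce (S : Set V)).edgeSet).toFinset.image (Sym2.map Subtype.val) := by
    ext e
    induction e with
    | _ a b =>
      rw [mk_mem_edgesWithin]
      simp only [Finset.mem_image, Set.Finite.mem_toFinset]
      constructor
      · rintro ⟨hab, ha, hb⟩
        exact ⟨s(⟨a, ha⟩, ⟨b, hb⟩), hab, rfl⟩
      · rintro ⟨⟨⟨c, hc⟩, ⟨d, hd⟩⟩, he, h⟩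
        have h' : s(c, d) = s(a, b) := h
        have he' : G.Adj c d := he
        rw [Sym2.eq_iff] at h'
        obtain ⟨rfl, rfl⟩ | ⟨rfl, rfl⟩ := h'
        · exact ⟨he', hc, hd⟩
        · exact ⟨he'.symm, hd, hc⟩
  have hinj : Function.Injective (Sym2.map (Subtype.val : ↥(S : Set V) → V)) :=
    Sym2.map.injective Subtype.val_injective
  rw [rootedSum, Finset.sum_filter, hedges, Finset.sum_powerset_image hinj, tuttePolynomial,
    finsetSum_coeff]
  refine Finset.sum_congr rfl fun A _ => ?_
  simp only [reachesRoot_image_val_iff hv]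
  rw [coeff_mul_C, coeff_X_pow, Finset.card_image_of_injective _ hinj]
  simp only [eq_comm (a := 1), ite_mul, one_mul, zero_mul]

/-! ### The bound on the linear coefficients. -/

theorem sum_norm_rootedSum_le {V : Type*} [Fintype V] [DecidableEq V] (v₀ : ℂ) (G : SimpleGraph V)
    [DecidableRel G.Adj] {Δ : ℕ} (hΔ : ∀ w, G.degree w ≤ Δ) {M : ℝ} (hM₁ : 1 ≤ M)
    (hM : ∀ a b, a + b ≤ Δ → ‖1 + v₀‖ ^ a * ‖v₀‖ ^ b ≤ M) (v : V) {t : ℕ} (ht : 1 ≤ t) :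
    ∑ S : Finset V with v ∈ S ∧ #S = t, ‖rootedSum v₀ G {v} S‖ ≤
      (Real.exp 1 * Δ * M) ^ (t - 1) := by
  have hM₀ : 0 < M := by linarith
  have key := sum_rooted_le_treeBound G hΔ (fun U S => ‖rootedSum v₀ G U S‖ / M ^ (#S - 1))
    (fun U S => by positivity) (by simp [rootedSum_empty_empty])
    (fun S hS => by simp [rootedSum_empty_of_nonempty v₀ G hS]) ?_ t ∅ {v} (by simp) (by simpa)
  · simp only [Finset.powerset_empty, Finset.sum_singleton, Finset.union_empty,
      Finset.card_empty, Finset.card_singleton, zero_add, mul_one, Finset.singleton_subset_iff]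
      at key
    have hsum : ∑ S : Finset V with v ∈ S ∧ #S = t, ‖rootedSum v₀ G {v} S‖ / M ^ (#S - 1) =
        (∑ S : Finset V with v ∈ S ∧ #S = t, ‖rootedSum v₀ G {v} S‖) / M ^ (t - 1) := by
      rw [Finset.sum_div]
      exact Finset.sum_congr rfl fun S hS => by rw [(Finset.mem_filter.1 hS).2.2]
    rw [hsum, div_le_iff₀ (by positivity)] at key
    refine key.trans ?_
    rw [mul_pow]
    gcongr
    exact treeBound_self_le Δ (t - 1)
  · intro u U S hu hUS
    have hfactor {B : Finset V} (hB : B ⊆ G.neighborFinset u ∩ (S \ U)) :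
        ‖1 + v₀‖ ^ #(G.neighborFinset u ∩ U) * ‖v₀‖ ^ #B * M ^ (#(S.erase u) - 1) ≤
          M ^ (#S - 1) := by
      have huS := hUS hu
      have hcard := Finset.card_erase_add_one huS
      -- For S = {u} both truncated exponents of M are 0, so no factor M is gained; none is needed,
      -- since u then has no neighbors in S.
      rcases Nat.eq_zero_or_pos #(S.erase u) with h | h
      · have hS : S = {u} := by
          rw [← Finset.insert_erase huS, Finset.card_eq_zero.1 h]
          rfl
        subst hS
        have hU : U = {u} := Finset.Subset.antisymm hUS (by simpa using hu)
        subst hU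
        have hB₀ : B = ∅ := by simpa using hB
        simp [hB₀]
      · rw [show #S - 1 = (#(S.erase u) - 1) + 1 by omega, pow_succ, mul_comm _ M]
        gcongr
        -- The neighbors of u in U and those in B are disjoint, so together they number at most Δ.
        refine hM _ _ (le_trans ?_ (hΔ u))
        rw [← SimpleGraph.card_neighborFinset_eq_degree, ← Finset.card_union_of_disjoint]
        · exact Finset.card_le_card (Finset.union_subset Finset.inter_subset_left
            (hB.trans Finset.inter_subset_left))
        · exact Finset.disjoint_sdiff.mono Finset.inter_subset_right
            (hB.trans Finset.inter_subset_right)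
    rw [rootedSum_eq_mul_sum v₀ G hu hUS, div_le_iff₀ (by positivity), norm_mul, norm_pow,
      Finset.sum_mul]
    refine (mul_le_mul_of_nonneg_left (norm_sum_le _ _) (by positivity)).trans ?_
    rw [Finset.mul_sum]
    refine Finset.sum_le_sum fun B hB => ?_
    rw [Finset.mem_powerset] at hB
    rw [norm_mul, norm_pow, ← mul_assoc, div_mul_eq_mul_div, le_div_iff₀ (by positivity)]
    calc _ = ‖rootedSum v₀ G (U.erase u ∪ B) (S.erase u)‖ *
          (‖1 + v₀‖ ^ #(G.neighborFinset u ∩ U) * ‖v₀‖ ^ #B * M ^ (#(S.erase u) - 1)) := by ring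
      _ ≤ _ := mul_le_mul_of_nonneg_left (hfactor hB) (norm_nonneg _)

theorem isBoundedExponentialType_tuttePolynomial {v₀ : ℂ} {M : ℕ → ℝ} (hM₁ : ∀ Δ, 1 ≤ M Δ)
    (hM : ∀ Δ a b, a + b ≤ Δ → ‖1 + v₀‖ ^ a * ‖v₀‖ ^ b ≤ M Δ) :
    (tuttePolynomial.{u} v₀).IsBoundedExponentialType (fun Δ => Real.exp 1 * Δ * M Δ) where
  isMonic := isMonic_tuttePolynomial v₀
  isExponentialType := isExponentialType_tuttePolynomial v₀
  bound_nonneg Δ := mul_nonneg (by positivity) (zero_le_one.trans (hM₁ Δ))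
  sum_le Δ V _ _ G _ hΔ v t ht := by
    rw [Finset.sum_congr rfl fun S hS => by
      rw [coeff_one_tuttePolynomial_induce v₀ G (Finset.mem_filter.1 hS).2.1]]
    exact sum_norm_rootedSum_le v₀ G hΔ (hM₁ Δ) (hM Δ) v ht

theorem proposition2p1 :
    (chromaticPolynomial.{u}.IsMultiplicative ∧
      chromaticPolynomial.{u}.IsBoundedExponentialType (fun Δ => Real.exp 1 * Δ)) ∧
    ∀ v₀ : ℂ,
      (tuttePolynomial.{u} v₀).IsMultiplicative ∧
      (tuttePolynomial.{u} v₀).IsBoundedExponentialType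
        (fun Δ => Real.exp 1 * Δ * (1 + ‖v₀‖) ^ Δ) := by
  refine ⟨?_, fun v₀ => ⟨isMultiplicative_tuttePolynomial v₀,
    isBoundedExponentialType_tuttePolynomial
      (fun Δ => one_le_pow₀ (by linarith [norm_nonneg v₀])) fun Δ a b hab => ?_⟩⟩
  · rw [chromaticPolynomial_eq_tuttePolynomial]
    refine ⟨isMultiplicative_tuttePolynomial (-1), ?_⟩
    simpa using isBoundedExponentialType_tuttePolynomial.{u} (v₀ := -1) (M := fun _ => 1)
      (fun _ => le_rfl) fun _ a b _ => by simpa using pow_le_one₀ le_rfl zero_le_one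
  · calc ‖1 + v₀‖ ^ a * ‖v₀‖ ^ b ≤ (1 + ‖v₀‖) ^ a * (1 + ‖v₀‖) ^ b := by
          gcongr
          · simpa using norm_add_le 1 v₀
          · linarith
      _ = (1 + ‖v₀‖) ^ (a + b) := (pow_add _ _ _).symm
      _ ≤ (1 + ‖v₀‖) ^ Δ := pow_le_pow_right₀ (by linarith [norm_nonneg v₀]) hab
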